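/- All groups are abelian and written additively. A group is called relatively co-Hopfian if it is not isomorphic to a proper direct summand of any of its proper subgroups; it is super relatively co-Hopfian if each of its homomorphic images is relatively co-Hopfian, and hereditarily relatively co-Hopfian if each of its subgroups is relatively co-Hopfian. For a group $G$ let $D(G)$ be its divisible part, i.e. its largest divisible subgroup, and write $G = D(G)\oplus R$, where $R$ is a reduced part of $G$. For a prime $p$, the $p$-component $T_p(A)$ of a group $A$ is the subgroup of its elements of $p$-power order. The torsion-free rank of a group is the cardinality of a maximal linearly independent (over $\mathbb{Z}$) set of its elements. The rank of a group is the cardinality of a maximal independent set of elements of infinite or prime-power order, where a set of non-zero elements is independent if the cyclic subgroups that they generate form a direct sum. Theorem. (1) A group $G$ is super relatively co-Hopfian if and only if the following conditions hold, for one (equivalently, every) choice of the reduced part $R$: - the torsion-free rank of $D(G)$ is finite, and for each prime $p$ the rank of $T_p(D(G))$ is finite; - the torsion-free rank of $R$ is finite, and for each prime $p$ the group $T_p(R)$ is finite. (2) A group $G$ is hereditarily relatively co-Hopfian if and only if it is super relatively co-Hopfian. -/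

import Mathlib

universe u

namespace RelCoHopf

/-- `G` is relatively co-Hopfian: `G` is not isomorphic to a proper direct summand of any of its
proper subgroups. Here `H` is the proper subgroup, and `H = A ⊕ B` with `A ≠ H`. -/
def IsRelativelyCoHopfian (G : Type u) [AddCommGroup G] : Prop :=
  ∀ H : AddSubgroup G, H ≠ ⊤ → ∀ A B : AddSubgroup H, IsCompl A B → A ≠ ⊤ → IsEmpty (G ≃+ A)

/-- Every homomorphic image of `G` is relatively co-Hopfian. -/
def IsSuperRelativelyCoHopfian (G : Type u) [AddCommGroup G] : Prop :=
  ∀ (H : Type u) [AddCommGroup H] (f : G →+ H), Function.Surjective f → IsRelativelyCoHopfian H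

/-- Every subgroup of `G` is relatively co-Hopfian. -/
def IsHereditarilyRelativelyCoHopfian (G : Type u) [AddCommGroup G] : Prop :=
  ∀ H : AddSubgroup G, IsRelativelyCoHopfian H

/-- A divisible subgroup: every element is divisible by every positive integer inside it. -/
def IsDivisibleSubgroup {G : Type u} [AddCommGroup G] (D : AddSubgroup G) : Prop :=
  ∀ n : ℕ, n ≠ 0 → ∀ x ∈ D, ∃ y ∈ D, n • y = x

/-- The divisible part of `G`: the subgroup generated by all divisible subgroups. It is the largest
divisible subgroup (`isDivisibleSubgroup_divisiblePart`, `le_divisiblePart`). -/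
def divisiblePart (G : Type u) [AddCommGroup G] : AddSubgroup G :=
  sSup {D | IsDivisibleSubgroup D}

theorem le_divisiblePart {G : Type u} [AddCommGroup G] {D : AddSubgroup G}
    (hD : IsDivisibleSubgroup D) : D ≤ divisiblePart G :=
  le_sSup hD

theorem isDivisibleSubgroup_divisiblePart (G : Type u) [AddCommGroup G] :
    IsDivisibleSubgroup (divisiblePart G) := by
  intro n hn
  have h : divisiblePart G ≤ (divisiblePart G).map (nsmulAddMonoidHom n) := by
    refine sSup_le fun D hD x hx => ?_
    obtain ⟨y, hy, rfl⟩ := hD n hn x hx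
    exact ⟨y, le_divisiblePart hD hy, rfl⟩
  intro x hx
  obtain ⟨y, hy, rfl⟩ := h hx
  exact ⟨y, hy, rfl⟩

/-- `R` is a reduced part of `G`: a complement of the divisible part, so that `G = D(G) ⊕ R`.
It is unique up to isomorphism, and exists by `exists_isReducedPart`. -/
def IsReducedPart {G : Type u} [AddCommGroup G] (R : AddSubgroup G) : Prop :=
  IsCompl (divisiblePart G) R

theorem exists_isReducedPart (G : Type u) [AddCommGroup G] :
    ∃ R : AddSubgroup G, IsReducedPart R := by
  have hdiv : ∀ {n : ℤ} , n ≠ 0 → Function.Surjective (fun a : divisiblePart G => n • a) := by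
    intro n hn x
    obtain ⟨y, hy, hyx⟩ := isDivisibleSubgroup_divisiblePart G n.natAbs (by simpa using hn)
      (n.sign • x : divisiblePart G) (SetLike.coe_mem _)
    refine ⟨⟨y, hy⟩, ?_⟩
    have h2 : n.natAbs • (⟨y, hy⟩ : divisiblePart G) = n.sign • x := Subtype.ext hyx
    have h3 : n = n.sign * (n.natAbs : ℤ) := by
      rw [Int.sign_mul_natAbs]
    have h4 : n.sign * n.sign = 1 := by
      rcases Int.lt_or_gt_of_ne hn with h | h
      · rw [Int.sign_eq_neg_one_of_neg h]; rfl
      · rw [Int.sign_eq_one_of_pos h]; rfl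
    change n • (⟨y, hy⟩ : divisiblePart G) = x
    rw [h3, mul_smul, natCast_zsmul, h2, ← mul_smul, h4, one_smul]
  have : DivisibleBy (divisiblePart G) ℤ := divisibleByOfSMulRightSurj _ _ hdiv
  obtain ⟨g, hg⟩ := (Module.Baer.of_divisible (divisiblePart G)).extension_property_addMonoidHom
    (divisiblePart G).subtype Subtype.val_injective (AddMonoidHom.id _)
  have hg' : ∀ x : divisiblePart G, g x = x := fun x => DFunLike.congr_fun hg x
  refine ⟨g.ker, ?_⟩
  refine IsCompl.of_eq ?_ ?_
  · rw [eq_bot_iff]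
    rintro x ⟨hx, hk⟩
    have h1 := hg' ⟨x, hx⟩
    have h2 : g x = 0 := hk
    rw [h2] at h1
    exact (congrArg Subtype.val h1).symm
  · rw [eq_top_iff]
    intro x _
    refine AddSubgroup.mem_sup.2 ⟨g x, (g x).2, x - g x, ?_, by abel⟩
    change g (x - g x) = 0
    rw [map_sub, hg', sub_self]

/-- An independent system of elements of infinite or prime power order: no element is zero, and the
cyclic subgroups that the elements generate form a direct sum. -/
def IsIndependentSystem {G : Type u} [AddCommGroup G] (S : Set G) : Prop :=
  (∀ x ∈ S, x ≠ 0 ∧ (addOrderOf x = 0 ∨ IsPrimePow (addOrderOf x))) ∧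
    iSupIndep fun x : S => AddSubgroup.zmultiples (x : G)

/-- The rank of an abelian group: the largest cardinality of an independent system of elements of
infinite or prime power order. -/
noncomputable def rank (G : Type u) [AddCommGroup G] : Cardinal.{u} :=
  ⨆ S : {S : Set G // IsIndependentSystem S}, Cardinal.mk S.1

/-- The torsion-free rank: the largest cardinality of a family of elements that is linearly
independent over `ℤ`. -/
noncomputable def torsionFreeRank (G : Type u) [AddCommGroup G] : Cardinal.{u} :=
  Module.rank ℤ G

end RelCoHopf

-- Being super relatively co-Hopfian and being hereditarily relatively co-Hopfian are both
-- equivalent to `HasFiniteRanks`: finite torsion-free rank, and a finite socle `G[p] = {x | p • x =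
-- 0}` for every prime `p`.
--
-- Sufficiency: let `φ` embed `G` in itself with `φ(G) ⊕ B ≤ G`. Additivity of rank makes `B`
-- torsion; as `φ` permutes each finite `G[p]`, `B` has no element of prime order, so `B = 0`. The
-- condition clearly passes to subgroups. It passes to a quotient `G/K` because the socle of `G/K`
-- is controlled by `G[p]` and `K/pK`, and `K/pK` is finite (`HasFiniteRanks.finiteModulo`).
--
-- Necessity: an infinite direct sum of copies of a nonzero group is never relatively co-Hopfian.
-- With subgroups, this applies to free subgroups and socles. With quotients, infinite rank gives a
-- surjection onto a countably infinite direct sum of copies of `ℚ`. For an infinite socle, `G/pG`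
-- must be finite, so factoring out a finitely generated subgroup makes the group `p`-divisible; its
-- `p`-component is then a divisible quotient, excluded by
-- `not_isRelativelyCoHopfian_of_divisible_primary`.
--
-- Finally `IsReducedPart.hasFiniteRanks_iff` splits the condition along `G = D(G) ⊕ R`.

universe v w

namespace RelCoHopf

/-! ### Reformulation by injective endomorphisms, and infinite direct sums. -/

/-- `G` fails to be relatively co-Hopfian exactly when some injective endomorphism has a range that
meets a non-trivial subgroup trivially without generating `G` together with it. -/
theorem isRelativelyCoHopfian_iff (G : Type u) [AddCommGroup G] :
    IsRelativelyCoHopfian G ↔ ∀ (φ : G →+ G) (B : AddSubgroup G), Function.Injective φ →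
      (∀ g, φ g ∈ B → g = 0) → (∃ x, ∀ g, ∀ b ∈ B, φ g + b ≠ x) → ∀ b ∈ B, b = 0 := by
  constructor
  · intro h φ B hφ hd ⟨x, hx⟩ b hb
    by_contra hb0
    have hrange : φ.range ≤ φ.range ⊔ B := le_sup_left
    have hB : B ≤ φ.range ⊔ B := le_sup_right
    refine (h (φ.range ⊔ B) ?_ (φ.range.addSubgroupOf _) (B.addSubgroupOf _) ?_ ?_).false
      ((AddMonoidHom.ofInjective hφ).trans (AddSubgroup.addSubgroupOfEquivOfLe hrange).symm)
    · intro htop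
      obtain ⟨_, ⟨g, rfl⟩, b, hb, he⟩ := AddSubgroup.mem_sup.1 (htop ▸ AddSubgroup.mem_top x)
      exact hx g b hb he
    · refine IsCompl.of_eq ?_ ?_
      · rw [eq_bot_iff]
        rintro ⟨y, hy⟩ ⟨⟨g, hg⟩, hyB⟩
        have hg' : φ g = y := hg
        have hyB' : y ∈ B := hyB
        have := hd g (hg' ▸ hyB')
        subst this
        exact Subtype.ext (by simpa using hg'.symm)
      · rw [eq_top_iff]
        rintro ⟨y, hy⟩ -
        obtain ⟨z, hz, b, hb, rfl⟩ := AddSubgroup.mem_sup.1 hy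
        exact AddSubgroup.mem_sup.2 ⟨⟨z, hrange hz⟩, hz, ⟨b, hB hb⟩, hb, rfl⟩
    · intro htop
      have : (⟨b, hB hb⟩ : ↥(φ.range ⊔ B)) ∈ φ.range.addSubgroupOf (φ.range ⊔ B) :=
        htop ▸ AddSubgroup.mem_top _
      obtain ⟨g, hg⟩ := this
      have hg' : φ g = b := hg
      have h0 := hd g (hg' ▸ hb)
      subst h0
      exact hb0 (by simpa using hg'.symm)
  · intro h H hH A B hAB hA
    refine ⟨fun e => hA ?_⟩
    have key := h (H.subtype.comp (A.subtype.comp e.toAddMonoidHom)) (B.map H.subtype)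
      (H.subtype_injective.comp (A.subtype_injective.comp e.injective)) ?_ ?_
    · have hB : B = ⊥ := by
        rw [eq_bot_iff]
        intro b hb
        exact Subtype.ext (key _ ⟨b, hb, rfl⟩)
      simpa [hB] using hAB.sup_eq_top
    · rintro g ⟨b, hb, hbg⟩
      have h1 : b = (e g : H) := Subtype.ext hbg
      have h2 : b = 0 := by
        have : b ∈ A ⊓ B := ⟨h1 ▸ (e g).2, hb⟩
        rwa [hAB.inf_eq_bot] at this
      have h3 : e g = 0 := Subtype.ext (h1.symm.trans h2)
      simpa using h3
    · obtain ⟨x, hx⟩ := not_forall.1 (mt (AddSubgroup.eq_top_iff' H).2 hH)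
      refine ⟨x, ?_⟩
      rintro g _ ⟨b, hb, rfl⟩ he
      exact hx (he ▸ H.add_mem (e g : H).2 b.2)

theorem IsRelativelyCoHopfian.of_addEquiv {G : Type u} {H : Type v} [AddCommGroup G]
    [AddCommGroup H] (e : G ≃+ H) (h : IsRelativelyCoHopfian G) : IsRelativelyCoHopfian H := by
  rw [isRelativelyCoHopfian_iff] at h ⊢
  rintro φ B hφ hd ⟨x, hx⟩ b hb
  have := h (e.symm.toAddMonoidHom.comp (φ.comp e.toAddMonoidHom)) (B.comap e.toAddMonoidHom)
    (e.symm.injective.comp (hφ.comp e.injective)) ?_ ⟨e.symm x, ?_⟩ (e.symm b) (by simpa using hb)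
  · simpa using this
  · intro g hg
    simpa using hd (e g) (by simpa using hg)
  · intro g c hc he
    refine hx (e g) (e c) hc ?_
    have := congrArg e he
    simpa using this

/-- Two missed indices are needed: in the direct sum, `a` carries the complement and `b` shows that
the image and the complement together do not fill the group. -/
theorem exists_injective_two_notMem_range (ι : Type v) [Infinite ι] :
    ∃ (f : ι → ι) (a b : ι), Function.Injective f ∧ a ∉ Set.range f ∧ b ∉ Set.range f ∧ a ≠ b := by
  have h : Cardinal.mk (ι ⊕ Bool) = Cardinal.mk ι := by
    have h1 : Cardinal.aleph0 ≤ Cardinal.mk ι := Cardinal.aleph0_le_mk ι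
    have h2 : (2 : Cardinal.{v}) ≤ Cardinal.mk ι := (Cardinal.natCast_lt_aleph0 (n := 2)).le.trans h1
    simpa using Cardinal.add_eq_left h1 h2
  obtain ⟨e⟩ := Cardinal.eq.1 h
  exact ⟨fun i => e (.inl i), e (.inr true), e (.inr false),
    e.injective.comp Sum.inl_injective, by simp, by simp, by simp⟩

theorem not_isRelativelyCoHopfian_finsupp (ι : Type v) [Infinite ι] (A : Type w) [AddCommGroup A]
    [Nontrivial A] : ¬ IsRelativelyCoHopfian (ι →₀ A) := by
  rw [isRelativelyCoHopfian_iff]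
  intro h
  obtain ⟨f, a, b, hf, ha, hb, hab⟩ := exists_injective_two_notMem_range ι
  obtain ⟨c, hc⟩ := exists_ne (0 : A)
  have := h (Finsupp.mapDomain.addMonoidHom f) (Finsupp.singleAddHom a).range
    (Finsupp.mapDomain_injective hf) ?_ ⟨Finsupp.single b c, ?_⟩ (Finsupp.single a c) ⟨c, rfl⟩
  · simp [hc] at this
  · rintro g ⟨c, hc⟩
    have hc' : Finsupp.single a c = Finsupp.mapDomain f g := hc
    have h0 : c = 0 := by
      have := congrArg (fun v => v a) hc'
      simpa [Finsupp.mapDomain_of_notMem_range _ _ ha] using this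
    rw [h0, Finsupp.single_zero] at hc'
    exact Finsupp.mapDomain_injective hf (by simpa using hc'.symm)
  · rintro g _ ⟨d, rfl⟩ he
    have he' : Finsupp.mapDomain f g + Finsupp.single a d = Finsupp.single b c := he
    have := congrArg (fun v => v b) he'
    simp [Finsupp.mapDomain_of_notMem_range _ _ hb, hab] at this
    exact hc this.symm

/-- Finite torsion-free rank together with finite `p`-socles, the group-level form of the conditions
on the divisible and the reduced part. -/
structure HasFiniteRanks (G : Type u) [AddCommGroup G] : Prop where
  rank_lt : Module.rank ℤ G < Cardinal.aleph0
  socle_finite : ∀ p : ℕ, p.Prime → {x : G | p • x = 0}.Finite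

/-! ### Finite ranks imply relative co-Hopficity. -/

section Basic

variable {G : Type u} {H : Type v} [AddCommGroup G] [AddCommGroup H]

theorem HasFiniteRanks.subgroup (h : HasFiniteRanks G) (K : AddSubgroup G) :
    HasFiniteRanks K where
  rank_lt := (LinearMap.rank_le_of_injective K.subtype.toIntLinearMap
    K.subtype_injective).trans_lt h.rank_lt
  socle_finite p hp := by
    refine Set.Finite.of_finite_image ((h.socle_finite p hp).subset ?_)
      K.subtype_injective.injOn
    rintro _ ⟨x, hx, rfl⟩
    have hx' : p • x = 0 := hx
    simpa using congrArg Subtype.val hx'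

theorem exists_nsmul_eq_zero_of_torsion {x : G} (hx : x ≠ 0) {a : ℕ} (ha : a ≠ 0)
    (hax : a • x = 0) : ∃ p m : ℕ, p.Prime ∧ m • x ≠ 0 ∧ p • m • x = 0 := by
  have hn : addOrderOf x ≠ 1 := by simpa using hx
  have h0 : 0 < addOrderOf x :=
    addOrderOf_pos_iff.2 (isOfFinAddOrder_iff_nsmul_eq_zero.2 ⟨a, Nat.pos_of_ne_zero ha, hax⟩)
  obtain ⟨p, hp, m, hm⟩ := Nat.exists_prime_and_dvd hn
  refine ⟨p, m, hp, fun h => ?_, by rw [← mul_smul, ← hm, addOrderOf_nsmul_eq_zero]⟩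
  have hd := addOrderOf_dvd_of_nsmul_eq_zero h
  have hm0 : 0 < m := Nat.pos_of_ne_zero fun h => by rw [h] at hm; omega
  have := Nat.le_of_dvd hm0 hd
  rw [hm] at this
  nlinarith [hp.two_le]

theorem HasFiniteRanks.isRelativelyCoHopfian (h : HasFiniteRanks G) :
    IsRelativelyCoHopfian G := by
  rw [isRelativelyCoHopfian_iff]
  rintro φ B hφ hd - b hb
  by_contra hb0
  -- The sum of `φ(G)` and `B` is direct, so `rank G + rank B ≤ rank G`, and a finite `rank G`
  -- cancels.
  have hrank : Module.rank ℤ (AddSubgroup.toIntSubmodule B) = 0 := by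
    have h1 := Submodule.rank_sup_add_rank_inf_eq (LinearMap.range φ.toIntLinearMap)
      (AddSubgroup.toIntSubmodule B)
    have h2 : LinearMap.range φ.toIntLinearMap ⊓ AddSubgroup.toIntSubmodule B = ⊥ := by
      rw [eq_bot_iff]
      rintro _ ⟨⟨g, rfl⟩, hg⟩
      have : g = 0 := hd g hg
      simp [this]
    rw [h2, rank_bot, add_zero,
      rank_range_of_injective φ.toIntLinearMap hφ] at h1
    have h3 := h1 ▸ Submodule.rank_le (LinearMap.range φ.toIntLinearMap ⊔
      AddSubgroup.toIntSubmodule B)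
    have h4 := (self_le_add_left _ _).trans h3
    have h5 := h.rank_lt
    have h6 := h4.trans_lt h5
    revert h3 h5 h6
    generalize Module.rank ℤ G = c
    generalize Module.rank ℤ (AddSubgroup.toIntSubmodule B) = d
    intro h3 h5 h6
    lift c to ℕ using h5
    lift d to ℕ using h6
    norm_cast at h3 ⊢
    omega
  obtain ⟨a, ha, hab⟩ := rank_eq_zero_iff.1 hrank ⟨b, hb⟩
  have hab' : a.natAbs • b = 0 := by
    have : a • b = 0 := congrArg Subtype.val hab
    rcases Int.natAbs_eq a with h | h <;> rw [h] at this <;> simpa using this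
  obtain ⟨p, m, hp, hm, hpm⟩ := exists_nsmul_eq_zero_of_torsion hb0 (by simpa using ha) hab'
  have hfin := h.socle_finite p hp
  have hmaps : Set.MapsTo φ {x : G | p • x = 0} {x : G | p • x = 0} := by
    intro x hx
    have hx' : p • x = 0 := hx
    change p • φ x = 0
    rw [← map_nsmul, hx', map_zero]
  have : Finite {x : G | p • x = 0} := hfin
  -- An injective self-map of the finite socle is onto, so the element `m • b` of order `p` lies in
  -- `φ(G) ∩ B`.
  obtain ⟨⟨g, hg⟩, hgm⟩ := Finite.surjective_of_injective
    ((hmaps.restrict_inj).2 hφ.injOn) ⟨m • b, hpm⟩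
  have hgm' : φ g = m • b := congrArg Subtype.val hgm
  have := hd g (hgm' ▸ B.nsmul_mem hb m)
  subst this
  exact hm (by simpa using hgm'.symm)

end Basic

/-! ### Finite ranks pass to homomorphic images. -/

section Finiteness

variable {G : Type u} {H : Type v} [AddCommGroup G] [AddCommGroup H] {p : ℕ}

theorem finite_nsmul_preimage (h : {x : G | p • x = 0}.Finite) {S : Set G} (hS : S.Finite) :
    {x : G | p • x ∈ S}.Finite := by
  refine hS.preimage' (f := fun x : G => p • x) fun b _ => ?_
  rcases Set.eq_empty_or_nonempty ((fun x : G => p • x) ⁻¹' {b}) with h0 | ⟨c, hc⟩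
  · rw [h0]; exact Set.finite_empty
  · refine (h.image (fun x => x + c)).subset fun x hx => ⟨x - c, ?_, by simp⟩
    have hx' : p • x = b := hx
    have hc' : p • c = b := hc
    change p • (x - c) = 0
    rw [smul_sub, hx', hc', sub_self]

theorem finite_pow_socle (h : {x : G | p • x = 0}.Finite) (n : ℕ) :
    {x : G | p ^ n • x = 0}.Finite := by
  induction n with
  | zero => simp
  | succ n ih =>
    refine (finite_nsmul_preimage h ih).subset fun x hx => ?_
    have hx' : p ^ (n + 1) • x = 0 := hx
    change p ^ n • p • x = 0
    rw [← mul_smul, ← pow_succ, hx']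

/-- In a `p`-group with finite socle the subgroups `p ^ n • G` become stationary. -/
theorem exists_pow_nsmul_eq_pow_succ_nsmul (h : {x : G | p • x = 0}.Finite)
    (ht : ∀ x : G, ∃ k : ℕ, p ^ k • x = 0) :
    ∃ N : ℕ, ∀ x : G, ∃ y : G, p ^ N • x = p ^ (N + 1) • y := by
  -- The socle elements divisible by `p ^ n` form a decreasing chain of finite sets, stationary from
  -- the index `N` of least cardinality.
  let S : ℕ → Set G := fun n => {s | p • s = 0 ∧ ∃ t, p ^ n • t = s}
  have hfin : ∀ n, (S n).Finite := fun n => h.subset fun s hs => hs.1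
  have hanti : ∀ n k, S (n + k) ⊆ S n := by
    rintro n k s ⟨hs, t, rfl⟩
    exact ⟨hs, p ^ k • t, by rw [← mul_smul, ← pow_add]⟩
  let N := Function.argmin (fun n => (S n).ncard)
  have hmin : ∀ n, (S N).ncard ≤ (S n).ncard := fun n => Function.argmin_le (fun n => (S n).ncard) n
  have heq : ∀ k, S N ⊆ S (N + k) := fun k =>
    (Set.eq_of_subset_of_ncard_le (hanti N k) (hmin _) (hfin _)).ge
  have key : ∀ (k : ℕ) (x : G), p ^ k • p ^ N • x = 0 → ∃ y : G, p ^ N • x = p ^ (N + 1) • y := by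
    intro k
    induction k with
    | zero => exact fun x hx => ⟨0, by simpa using hx⟩
    | succ k ih =>
      intro x hx
      -- This socle element equals `p ^ (N + k + 1) • z`, so replacing `x` by `x - p • z` lowers the
      -- exponent that kills `p ^ N • x`.
      have hs : p ^ k • p ^ N • x ∈ S N :=
        ⟨by rw [← mul_smul, ← pow_succ', hx], p ^ k • x, by rw [smul_comm]⟩
      obtain ⟨-, z, hz⟩ := heq (k + 1) hs
      obtain ⟨y, hy⟩ := ih (x - p • z) (by
        rw [smul_sub, smul_sub, ← hz, sub_eq_zero]
        simp only [← mul_smul]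
        congr 1
        ring)
      refine ⟨y + z, ?_⟩
      rw [smul_add, ← hy, smul_sub, ← mul_smul, ← pow_succ, sub_add_cancel]
  refine ⟨N, fun x => ?_⟩
  obtain ⟨k, hk⟩ := ht x
  exact key k x (by rw [smul_comm, hk, smul_zero])

/-- The quotient `G ⧸ p • G` is finite, phrased through representatives. -/
def FiniteModulo (G : Type u) [AddCommGroup G] (p : ℕ) : Prop :=
  ∃ S : Set G, S.Finite ∧ ∀ x, ∃ s ∈ S, ∃ y, x = s + p • y

theorem FiniteModulo.of_finite_quotient
    (h : Finite (G ⧸ (nsmulAddMonoidHom p : G →+ G).range)) : FiniteModulo G p := by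
  refine ⟨Set.range (Quotient.out : G ⧸ (nsmulAddMonoidHom p : G →+ G).range → G),
    Set.finite_range _, fun x => ⟨_, ⟨(x : G ⧸ (nsmulAddMonoidHom p : G →+ G).range), rfl⟩, ?_⟩⟩
  have h1 := QuotientAddGroup.eq.1
    (QuotientAddGroup.out_eq' (x : G ⧸ (nsmulAddMonoidHom p : G →+ G).range))
  obtain ⟨y, hy⟩ := h1
  exact ⟨y, by rw [show p • y = _ from hy, add_neg_cancel_left]⟩

theorem FiniteModulo.of_fg [Module.Finite ℤ G] (hp : p ≠ 0) : FiniteModulo G p := by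
  apply FiniteModulo.of_finite_quotient
  let P : Submodule ℤ G := AddSubgroup.toIntSubmodule (nsmulAddMonoidHom p : G →+ G).range
  have : Module.Finite ℤ (G ⧸ P) := inferInstance
  have htor : Module.IsTorsion ℤ (G ⧸ P) := by
    intro x
    obtain ⟨g, rfl⟩ := P.mkQ_surjective x
    refine ⟨⟨(p : ℤ), mem_nonZeroDivisors_of_ne_zero (by exact_mod_cast hp)⟩, ?_⟩
    change (p : ℤ) • P.mkQ g = 0
    rw [← map_smul]
    refine (Submodule.Quotient.mk_eq_zero P).2 ⟨g, ?_⟩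
    simp
  exact Module.finite_of_fg_torsion (G ⧸ P) htor

/-- The prime-to-`p` part of a torsion element is divisible by `p`. In the `p`-component, `p ^ N • x
= p ^ (N + 1) • y` puts `x - p • y` in the finite set `G[p ^ N]`, which therefore serves as a set of
representatives. -/
theorem FiniteModulo.of_torsion (hp : p.Prime) (h : {x : G | p • x = 0}.Finite)
    (ht : ∀ x : G, ∃ a : ℕ, a ≠ 0 ∧ a • x = 0) : FiniteModulo G p := by
  let T := AddCommGroup.primaryComponent G p
  have hT : {x : T | p • x = 0}.Finite := by
    refine Set.Finite.of_finite_image (h.subset ?_) T.subtype_injective.injOn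
    rintro _ ⟨x, hx, rfl⟩
    have hx' : p • x = 0 := hx
    simpa using congrArg Subtype.val hx'
  obtain ⟨N, hN⟩ := exists_pow_nsmul_eq_pow_succ_nsmul hT fun x => by
    obtain ⟨k, hk⟩ := AddCommGroup.mem_primaryComponent.1 x.2
    exact ⟨k, Subtype.ext hk⟩
  refine ⟨_, finite_pow_socle h N, fun t => ?_⟩
  obtain ⟨a, ha, hat⟩ := ht t
  obtain ⟨k, m, hm, rfl⟩ := Nat.exists_eq_pow_mul_and_not_dvd ha p hp.ne_one
  obtain ⟨u, v, huv⟩ : IsCoprime (m : ℤ) (p : ℤ) :=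
    Nat.isCoprime_iff_coprime.2 ((Nat.Prime.coprime_iff_not_dvd hp).2 hm).symm
  have hx : u • m • t ∈ T := AddCommGroup.mem_primaryComponent.2
    ⟨k, by rw [smul_comm, ← mul_smul (p ^ k), hat, smul_zero]⟩
  obtain ⟨y, hy⟩ := hN ⟨_, hx⟩
  have hy' : p ^ N • u • m • t = p ^ (N + 1) • (y : G) := congrArg Subtype.val hy
  refine ⟨u • m • t - p • (y : G), ?_, y + v • t, ?_⟩
  · change p ^ N • (u • m • t - p • (y : G)) = 0
    rw [smul_sub, hy', ← mul_smul, ← pow_succ, sub_self]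
  · have : (u * m + v * p) • t = t := by rw [huv, one_smul]
    rw [add_smul, mul_smul, mul_smul, natCast_zsmul, natCast_zsmul] at this
    rw [smul_add, smul_comm p v, ← add_assoc, sub_add_cancel, this]

/-- This is the exactness of `G[p] → H[p] → K/pK` for `K = f.ker`: a lift `g` of a socle element has
`p • g ∈ K`, and correcting `g` by an element of `K` moves `p • g` into the finite set of
representatives. -/
theorem finite_socle_of_surjective (f : G →+ H) (hf : Function.Surjective f)
    (h : {x : G | p • x = 0}.Finite) (hker : FiniteModulo f.ker p) :
    {x : H | p • x = 0}.Finite := by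
  obtain ⟨S, hS, hS'⟩ := hker
  refine ((finite_nsmul_preimage h (hS.image Subtype.val)).image f).subset fun x hx => ?_
  have hx' : p • x = 0 := hx
  obtain ⟨g, rfl⟩ := hf x
  obtain ⟨s, hs, y, hy⟩ := hS' ⟨p • g, by rw [AddMonoidHom.mem_ker, map_nsmul, hx']⟩
  have hy' : p • g = s + p • (y : G) := congrArg Subtype.val hy
  refine ⟨g - y, ⟨s, hs, ?_⟩, ?_⟩
  · rw [smul_sub, hy', add_sub_cancel_right]
  · rw [map_sub, (AddMonoidHom.mem_ker).1 y.2, sub_zero]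

theorem FiniteModulo.of_extension (f : G →+ H) (hf : Function.Surjective f)
    (hker : FiniteModulo f.ker p) (hH : FiniteModulo H p) : FiniteModulo G p := by
  obtain ⟨S, hS, hS'⟩ := hker
  obtain ⟨U, hU, hU'⟩ := hH
  choose r hr using hf
  refine ⟨_, (hU.image r).image2 (· + ·) (hS.image Subtype.val), fun x => ?_⟩
  obtain ⟨s, hs, y, hy⟩ := hU' (f x)
  obtain ⟨s', hs', y', hy'⟩ := hS' ⟨x - r s - p • r y, by
    rw [AddMonoidHom.mem_ker, map_sub, map_sub, map_nsmul, hr, hr, hy]; abel⟩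
  have hy'' : x - r s - p • r y = s' + p • (y' : G) := congrArg Subtype.val hy'
  refine ⟨_, ⟨r s, ⟨s, hs, rfl⟩, s', ⟨s', hs', rfl⟩, rfl⟩, y' + r y, ?_⟩
  rw [smul_add, add_assoc, ← add_assoc (s' : G), ← hy'']
  abel

/-- A maximal independent set spans a finitely generated `F` with `G ⧸ F` torsion. Both ends of the
extension are finite modulo `p`; the socle of `G ⧸ F` is finite because `F` is finite modulo `p`. -/
theorem HasFiniteRanks.finiteModulo (h : HasFiniteRanks G) (hp : p.Prime) : FiniteModulo G p := by
  obtain ⟨s, hs, hli⟩ := exists_set_linearIndependent ℤ G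
  let F := Submodule.span ℤ s
  have hsfin : s.Finite := Cardinal.lt_aleph0_iff_set_finite.1 (hs ▸ h.rank_lt)
  have : Module.Finite ℤ F := Module.Finite.iff_fg.2 (Submodule.fg_span hsfin)
  have hF : Module.rank ℤ F = Module.rank ℤ G := (rank_span_set hli).trans hs
  have hq : Module.rank ℤ (G ⧸ F) = 0 := by
    have h1 := F.rank_quotient_add_rank
    have h2 : Module.rank ℤ (G ⧸ F) ≤ Module.rank ℤ G := h1 ▸ self_le_add_right _ _
    have h5 := h.rank_lt
    have h6 := h2.trans_lt h5
    rw [hF] at h1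
    revert h1 h5 h6
    generalize Module.rank ℤ G = c
    generalize Module.rank ℤ (G ⧸ F) = d
    intro h1 h5 h6
    lift c to ℕ using h5
    lift d to ℕ using h6
    norm_cast at h1 ⊢
    omega
  let f : G →+ G ⧸ F := F.mkQ.toAddMonoidHom
  have hf : Function.Surjective f := F.mkQ_surjective
  have hker : FiniteModulo f.ker p := by
    have e : f.ker = F.toAddSubgroup := by
      ext x
      exact Submodule.Quotient.mk_eq_zero F
    rw [e]
    exact FiniteModulo.of_fg (G := F) hp.ne_zero
  refine FiniteModulo.of_extension f hf hker (FiniteModulo.of_torsion hp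
    (finite_socle_of_surjective f hf (h.socle_finite p hp) hker) fun x => ?_)
  obtain ⟨a, ha, hax⟩ := rank_eq_zero_iff.1 hq x
  refine ⟨a.natAbs, by simpa using ha, ?_⟩
  rcases Int.natAbs_eq a with h | h <;> rw [h] at hax <;> simpa using hax

theorem HasFiniteRanks.of_surjective {G H : Type u} [AddCommGroup G] [AddCommGroup H]
    (h : HasFiniteRanks G) (f : G →+ H) (hf : Function.Surjective f) : HasFiniteRanks H where
  rank_lt := (LinearMap.rank_le_of_surjective f.toIntLinearMap hf).trans_lt h.rank_lt
  socle_finite p hp := finite_socle_of_surjective f hf (h.socle_finite p hp)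
    ((h.subgroup f.ker).finiteModulo hp)

end Finiteness

/-! ### Each of the two properties forces finite ranks. -/

section Necessity

variable {G : Type u} [AddCommGroup G] {p : ℕ}

theorem exists_basis_zmod_of_infinite [Infinite G] [Fact p.Prime] [Module (ZMod p) G] :
    ∃ ι : Type u, Infinite ι ∧ Nonempty (Module.Basis ι (ZMod p) G) := by
  refine ⟨_, ?_, ⟨Module.Basis.ofVectorSpace (ZMod p) G⟩⟩
  by_contra h
  rw [not_infinite_iff_finite] at h
  exact not_finite_iff_infinite.2 ‹Infinite G›
    (Finite.of_equiv _ (Module.Basis.ofVectorSpace (ZMod p) G).equivFun.symm.toEquiv)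

theorem not_isRelativelyCoHopfian_of_elementary [Infinite G] (hp : p.Prime)
    (h : ∀ x : G, p • x = 0) : ¬ IsRelativelyCoHopfian G := by
  have : Fact p.Prime := ⟨hp⟩
  let _ : Module (ZMod p) G := AddCommGroup.zmodModule h
  obtain ⟨ι, hι, ⟨b⟩⟩ := exists_basis_zmod_of_infinite (G := G) (p := p)
  exact fun hG => not_isRelativelyCoHopfian_finsupp ι (ZMod p) (hG.of_addEquiv b.repr.toAddEquiv)

/-- On a `p`-group, multiplication by an integer prime to `p` is onto by Bézout, so divisibility by
`p` suffices. -/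
theorem nsmul_surjective_of_prime (hp : p.Prime) (ht : ∀ x : G, ∃ k : ℕ, p ^ k • x = 0)
    (hd : ∀ x : G, ∃ y : G, p • y = x) {n : ℕ} (hn : n ≠ 0) (x : G) : ∃ y : G, n • y = x := by
  obtain ⟨k, m, hm, rfl⟩ := Nat.exists_eq_pow_mul_and_not_dvd hn p hp.ne_one
  have hpow : ∀ (k : ℕ) (x : G), ∃ y : G, p ^ k • y = x := by
    intro k
    induction k with
    | zero => exact fun x => ⟨x, by simp⟩
    | succ k ih =>
      intro x
      obtain ⟨y, rfl⟩ := hd x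
      obtain ⟨z, rfl⟩ := ih y
      exact ⟨z, by rw [pow_succ', mul_smul]⟩
  obtain ⟨y, rfl⟩ := hpow k x
  obtain ⟨j, hj⟩ := ht y
  obtain ⟨u, v, huv⟩ : IsCoprime (m : ℤ) ((p ^ j : ℕ) : ℤ) :=
    Nat.isCoprime_iff_coprime.2 (((Nat.Prime.coprime_iff_not_dvd hp).2 hm).symm.pow_right j)
  refine ⟨u • y, ?_⟩
  have : (u * m + v * (p ^ j : ℕ)) • y = y := by rw [huv, one_smul]
  rw [add_smul, mul_smul, mul_smul, natCast_zsmul, natCast_zsmul, hj, smul_zero, add_zero] at this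
  rw [mul_smul, smul_comm m u, this]

theorem baer_of_nsmul_surjective (h : ∀ n : ℕ, n ≠ 0 → ∀ x : G, ∃ y : G, n • y = x) :
    Module.Baer ℤ G := by
  have hs : ∀ {n : ℤ}, n ≠ 0 → Function.Surjective (fun a : G => n • a) := by
    intro n hn x
    obtain ⟨y, hy⟩ := h n.natAbs (by simpa using hn) x
    rcases Int.natAbs_eq n with h | h
    · exact ⟨y, by dsimp only; rw [h, natCast_zsmul, hy]⟩
    · exact ⟨-y, by dsimp only; rw [h, neg_smul_neg, natCast_zsmul, hy]⟩
  have : DivisibleBy G ℤ := divisibleByOfSMulRightSurj _ _ hs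
  exact Module.Baer.of_divisible G

/-- The infinite socle is a vector space over `ZMod p` and so has a bad endomorphism `s` with
complement `B`. Divisible groups are injective, so `s` extends to `φ : G →+ G`; it stays injective
because a nonzero kernel would meet the socle. -/
theorem not_isRelativelyCoHopfian_of_divisible_primary (hp : p.Prime)
    (ht : ∀ x : G, ∃ k : ℕ, p ^ k • x = 0) (hd : ∀ x : G, ∃ y : G, p • y = x)
    (hinf : {x : G | p • x = 0}.Infinite) : ¬ IsRelativelyCoHopfian G := by
  let V : AddSubgroup G := (nsmulAddMonoidHom p : G →+ G).ker
  have hV : ∀ x : G, x ∈ V ↔ p • x = 0 := fun x => Iff.rfl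
  have : Infinite V := hinf.to_subtype
  have hn : ¬ IsRelativelyCoHopfian V :=
    not_isRelativelyCoHopfian_of_elementary hp fun x => Subtype.ext x.2
  rw [isRelativelyCoHopfian_iff] at hn ⊢
  push Not at hn
  obtain ⟨s, B, hs, hsB, -, b, hb, hb0⟩ := hn
  obtain ⟨φ, hφ⟩ := (baer_of_nsmul_surjective fun n hn x =>
    nsmul_surjective_of_prime hp ht hd hn x).extension_property_addMonoidHom
      V.subtype V.subtype_injective (V.subtype.comp s)
  have hφ' : ∀ x : V, φ x = s x := fun x => DFunLike.congr_fun hφ x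
  have hker : ∀ (k : ℕ) (x : G), p ^ k • x = 0 → φ x = 0 → x = 0 := by
    intro k
    induction k with
    | zero => exact fun x hx _ => by simpa using hx
    | succ k ih =>
      intro x hx h0
      have hx' : x ∈ V := ih (p • x) (by rw [← mul_smul, ← pow_succ, hx])
        (by rw [map_nsmul, h0, smul_zero])
      have h1 : s ⟨x, hx'⟩ = 0 := Subtype.ext ((hφ' ⟨x, hx'⟩).symm.trans h0)
      exact congrArg Subtype.val ((map_eq_zero_iff s hs).1 h1)
  have hinj : Function.Injective φ := (injective_iff_map_eq_zero φ).2 fun x hx =>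
    let ⟨k, hk⟩ := ht x; hker k x hk hx
  have hdisj : ∀ g, φ g ∈ B.map V.subtype → g = 0 := by
    rintro g ⟨c, hc, hcg⟩
    have hcg' : (c : G) = φ g := hcg
    have hg : g ∈ V := by
      rw [hV, ← map_eq_zero_iff φ hinj, map_nsmul, ← hcg']
      exact c.2
    have h1 : c = s ⟨g, hg⟩ := Subtype.ext (hcg'.trans (hφ' ⟨g, hg⟩))
    exact congrArg Subtype.val (hsB ⟨g, hg⟩ (h1 ▸ hc))
  intro h
  -- A `p`-th part `z` of `b` is outside `φ(G) + B`: since `p` kills `B`, `z = φ g + c` would give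
  -- `b = φ (p • g)`, a nonzero element of `φ(G) ∩ B`.
  obtain ⟨z, hz⟩ := hd b
  refine hb0 (Subtype.ext (h φ (B.map V.subtype) hinj hdisj ⟨z, ?_⟩ b ⟨b, hb, rfl⟩))
  rintro g _ ⟨c, hc, rfl⟩ rfl
  have h1 : φ (p • g) = b := by
    have hc0 : p • (c : G) = 0 := c.2
    rw [← hz, smul_add, map_nsmul]
    simp [hc0]
  have h2 := hdisj (p • g) ⟨b, hb, h1.symm⟩
  rw [h2, map_zero] at h1
  exact hb0 (Subtype.ext h1.symm)

theorem finite_socle_of_fg [Module.Finite ℤ G] (hp : p ≠ 0) : {x : G | p • x = 0}.Finite := by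
  let P : Submodule ℤ G := Submodule.torsionBy ℤ G p
  have htor : Module.IsTorsion ℤ P := fun {x} =>
    ⟨⟨(p : ℤ), mem_nonZeroDivisors_of_ne_zero (by exact_mod_cast hp)⟩, Subtype.ext x.2⟩
  have : Finite P := Module.finite_of_fg_torsion P htor
  refine (Set.toFinite (P : Set G)).subset fun x hx => ?_
  have hx' : p • x = 0 := hx
  simpa [P] using hx'

theorem IsSuperRelativelyCoHopfian.of_surjective {H : Type u} [AddCommGroup H]
    (h : IsSuperRelativelyCoHopfian G) (f : G →+ H) (hf : Function.Surjective f) :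
    IsSuperRelativelyCoHopfian H :=
  fun K _ g hg => h K (g.comp f) (hg.comp hf)

/-- A quotient that is divisible by `p` has its `p`-component as a direct summand. -/
theorem IsSuperRelativelyCoHopfian.finite_socle_of_divisible (h : IsSuperRelativelyCoHopfian G)
    (hp : p.Prime) (hd : ∀ x : G, ∃ y : G, p • y = x) : {x : G | p • x = 0}.Finite := by
  by_contra hinf
  let T := AddCommGroup.primaryComponent G p
  have ht : ∀ x : T, ∃ k : ℕ, p ^ k • x = 0 := fun x => by
    obtain ⟨k, hk⟩ := AddCommGroup.mem_primaryComponent.1 x.2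
    exact ⟨k, Subtype.ext hk⟩
  have hTd : ∀ x : T, ∃ y : T, p • y = x := by
    rintro ⟨x, k, hk⟩
    obtain ⟨y, rfl⟩ := hd x
    exact ⟨⟨y, k + 1, by rw [pow_succ, mul_smul, hk]⟩, rfl⟩
  obtain ⟨r, hr⟩ := (baer_of_nsmul_surjective fun n hn x =>
    nsmul_surjective_of_prime hp ht hTd hn x).extension_property_addMonoidHom
      T.subtype T.subtype_injective (AddMonoidHom.id T)
  refine not_isRelativelyCoHopfian_of_divisible_primary hp ht hTd ?_
    (h T r fun x => ⟨x, DFunLike.congr_fun hr x⟩)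
  intro hfin
  refine hinf ((hfin.image Subtype.val).subset fun x hx => ?_)
  have hx' : p • x = 0 := hx
  exact ⟨⟨x, 1, by rw [pow_one, hx']⟩, Subtype.ext hx', rfl⟩

theorem IsSuperRelativelyCoHopfian.finite_socle (h : IsSuperRelativelyCoHopfian G)
    (hp : p.Prime) : {x : G | p • x = 0}.Finite := by
  have hfin : Finite (G ⧸ (nsmulAddMonoidHom p : G →+ G).range) := by
    by_contra hinf
    have : Infinite (G ⧸ (nsmulAddMonoidHom p : G →+ G).range) := not_finite_iff_infinite.1 hinf
    refine not_isRelativelyCoHopfian_of_elementary hp (fun x => ?_)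
      (h _ (QuotientAddGroup.mk' (nsmulAddMonoidHom p : G →+ G).range)
        (QuotientAddGroup.mk'_surjective _))
    obtain ⟨g, rfl⟩ := QuotientAddGroup.mk'_surjective _ x
    rw [← map_nsmul]
    exact (QuotientAddGroup.eq_zero_iff _).2 ⟨g, rfl⟩
  obtain ⟨S, hS, hS'⟩ := FiniteModulo.of_finite_quotient hfin
  let N := Submodule.span ℤ S
  have : Module.Finite ℤ N := Module.Finite.iff_fg.2 (Submodule.fg_span hS)
  have hq : {x : G ⧸ N | p • x = 0}.Finite := by
    refine (h.of_surjective N.mkQ.toAddMonoidHom N.mkQ_surjective).finite_socle_of_divisible hp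
      fun x => ?_
    obtain ⟨g, rfl⟩ := N.mkQ_surjective x
    obtain ⟨s, hs, y, rfl⟩ := hS' g
    refine ⟨N.mkQ y, ?_⟩
    have : N.mkQ s = 0 := (Submodule.Quotient.mk_eq_zero N).2 (Submodule.subset_span hs)
    rw [map_add, this, zero_add, map_nsmul]
  have hN := (finite_socle_of_fg (G := N) hp.ne_zero).image Subtype.val
  -- Two socle elements with the same class differ by an element of `N[p]`, which is finite as `N`
  -- is finitely generated.
  refine Set.Finite.of_finite_fibers N.mkQ (hq.subset ?_) ?_
  · rintro _ ⟨x, hx, rfl⟩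
    have hx' : p • x = 0 := hx
    change p • N.mkQ x = 0
    rw [← map_nsmul, hx', map_zero]
  · rintro _ ⟨x, hx, rfl⟩
    have hx' : p • x = 0 := hx
    refine (hN.image (· + x)).subset ?_
    rintro y ⟨hy, hyx⟩
    have hy' : p • y = 0 := hy
    refine ⟨y - x, ⟨⟨y - x, (Submodule.Quotient.eq N).1 hyx⟩, Subtype.ext ?_, rfl⟩, by simp⟩
    change p • (y - x) = 0
    rw [smul_sub, hy', hx', sub_self]

/-- An infinite independent set maps onto the countable group `ULift ℕ →₀ ℚ`. This extends linearly
to its span, and then to all of `G` because the target is divisible. -/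
theorem IsSuperRelativelyCoHopfian.rank_lt (h : IsSuperRelativelyCoHopfian G) :
    Module.rank ℤ G < Cardinal.aleph0 := by
  by_contra hr
  obtain ⟨s, hs, hli⟩ := exists_set_linearIndependent ℤ G
  have hinf : Infinite s := Cardinal.infinite_iff.2 (hs ▸ not_lt.1 hr)
  obtain ⟨c, hc⟩ : ∃ c : s → (ULift.{u} ℕ →₀ ℚ), Function.Surjective c := by
    obtain ⟨d, hd⟩ := exists_surjective_nat (ULift.{u} ℕ →₀ ℚ)
    exact ⟨d ∘ Function.invFun (Infinite.natEmbedding s),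
      hd.comp (Function.invFun_surjective (Infinite.natEmbedding s).injective)⟩
  let b := Module.Basis.span (R := ℤ) (v := ((↑) : s → G)) hli
  let g := b.constr ℤ c
  have hQ : Module.Baer ℤ (ULift.{u} ℕ →₀ ℚ) := baer_of_nsmul_surjective fun n hn x =>
    ⟨(n : ℚ)⁻¹ • x, by
      rw [← Nat.cast_smul_eq_nsmul ℚ, smul_smul, mul_inv_cancel₀ (by exact_mod_cast hn), one_smul]⟩
  obtain ⟨f, hf⟩ := hQ.extension_property (Submodule.subtype _) Subtype.val_injective g
  refine not_isRelativelyCoHopfian_finsupp (ULift.{u} ℕ) ℚ (h _ f.toAddMonoidHom fun x => ?_)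
  obtain ⟨i, rfl⟩ := hc x
  exact ⟨b i, (LinearMap.congr_fun hf (b i)).trans (b.constr_basis ℤ c i)⟩

theorem IsSuperRelativelyCoHopfian.hasFiniteRanks (h : IsSuperRelativelyCoHopfian G) :
    HasFiniteRanks G :=
  ⟨h.rank_lt, fun _ hp => h.finite_socle hp⟩

theorem IsHereditarilyRelativelyCoHopfian.hasFiniteRanks
    (h : IsHereditarilyRelativelyCoHopfian G) : HasFiniteRanks G where
  rank_lt := by
    by_contra hr
    obtain ⟨s, hs, hli⟩ := exists_set_linearIndependent ℤ G
    have hinf : Infinite s := Cardinal.infinite_iff.2 (hs ▸ not_lt.1 hr)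
    let b := Module.Basis.span (R := ℤ) (v := ((↑) : s → G)) hli
    exact not_isRelativelyCoHopfian_finsupp s ℤ
      ((h (Submodule.span ℤ (Set.range ((↑) : s → G))).toAddSubgroup).of_addEquiv b.repr.toAddEquiv)
  socle_finite p hp := by
    by_contra hinf
    have : Infinite (nsmulAddMonoidHom p : G →+ G).ker := Set.Infinite.to_subtype hinf
    exact not_isRelativelyCoHopfian_of_elementary hp (fun x => Subtype.ext x.2)
      (h (nsmulAddMonoidHom p : G →+ G).ker)

theorem HasFiniteRanks.isHereditarilyRelativelyCoHopfian (h : HasFiniteRanks G) :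
    IsHereditarilyRelativelyCoHopfian G :=
  fun K => (h.subgroup K).isRelativelyCoHopfian

theorem HasFiniteRanks.isSuperRelativelyCoHopfian (h : HasFiniteRanks G) :
    IsSuperRelativelyCoHopfian G :=
  fun _ _ f hf => (h.of_surjective f hf).isRelativelyCoHopfian

end Necessity

/-! ### Translation to the divisible and reduced parts. -/

section Parts

variable {G : Type u} [AddCommGroup G] {p : ℕ}

/-- Every element of the system has a nonzero multiple in the socle, and distinct elements give
distinct multiples since their cyclic subgroups meet trivially. -/
theorem IsIndependentSystem.mk_le {S : Set G} (h : IsIndependentSystem S)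
    (ht : ∀ x : G, ∃ k : ℕ, p ^ k • x = 0) :
    Cardinal.mk S ≤ Cardinal.mk {x : G | p • x = 0} := by
  have hex : ∀ x : S, ∃ n : ℕ, n • (x : G) ≠ 0 ∧ p • n • (x : G) = 0 := by
    intro x
    have hk : ∃ k : ℕ, p ^ k • (x : G) = 0 := ht x
    classical
    rcases hf : Nat.find hk with _ | k
    · have := Nat.find_spec hk
      rw [hf, pow_zero, one_smul] at this
      exact absurd this (h.1 x x.2).1
    · refine ⟨p ^ k, Nat.find_min hk (by omega), ?_⟩
      rw [← mul_smul, ← pow_succ', ← hf]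
      exact Nat.find_spec hk
  choose n hn0 hn using hex
  refine Cardinal.mk_le_of_injective (f := fun x : S => ⟨n x • (x : G), hn x⟩) fun x y hxy => ?_
  by_contra hne
  have hxy' : n x • (x : G) = n y • (y : G) := congrArg Subtype.val hxy
  refine hn0 x ((AddSubgroup.disjoint_def.1 (h.2.pairwiseDisjoint hne))
    (AddSubgroup.nsmul_mem_zmultiples _ _) ?_)
  rw [hxy']
  exact AddSubgroup.nsmul_mem_zmultiples _ _

theorem rank_lt_of_finite_socle (ht : ∀ x : G, ∃ k : ℕ, p ^ k • x = 0)
    (h : {x : G | p • x = 0}.Finite) : rank G < Cardinal.aleph0 :=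
  (ciSup_le' fun S => S.2.mk_le ht).trans_lt (Cardinal.lt_aleph0_iff_set_finite.2 h)

theorem iSupIndep_zmultiples_basis {ι : Type v} [Module (ZMod p) G]
    (b : Module.Basis ι (ZMod p) G) : iSupIndep fun i => AddSubgroup.zmultiples (b i) := by
  have hz : ∀ i, (AddSubgroup.toZModSubmodule p).symm (Submodule.span (ZMod p) {b i}) =
      AddSubgroup.zmultiples (b i) := by
    intro i
    refine le_antisymm ?_ (AddSubgroup.zmultiples_le_of_mem (Submodule.mem_span_singleton_self _))
    exact (Submodule.span_singleton_le_iff_mem (b i)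
      (AddSubgroup.toZModSubmodule p (AddSubgroup.zmultiples (b i)))).2
        (AddSubgroup.mem_zmultiples _)
  have h1 := (b.linearIndependent.iSupIndep_span_singleton).map_orderIso
    (AddSubgroup.toZModSubmodule p).symm
  simpa only [Function.comp_def, hz] using h1

theorem exists_iSupIndep_zmultiples_of_elementary [Infinite G] (hp : p.Prime)
    (h : ∀ x : G, p • x = 0) :
    ∃ (ι : Type u) (b : ι → G), Infinite ι ∧ Function.Injective b ∧ (∀ i, b i ≠ 0) ∧
      iSupIndep fun i => AddSubgroup.zmultiples (b i) := by
  have : Fact p.Prime := ⟨hp⟩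
  let _ : Module (ZMod p) G := AddCommGroup.zmodModule h
  obtain ⟨ι, hι, ⟨b⟩⟩ := exists_basis_zmod_of_infinite (G := G) (p := p)
  exact ⟨ι, _, hι, b.injective, fun i => b.ne_zero i, iSupIndep_zmultiples_basis b⟩

theorem finite_socle_of_rank_lt (hp : p.Prime) (h : rank G < Cardinal.aleph0) :
    {x : G | p • x = 0}.Finite := by
  by_contra hinf
  let V : AddSubgroup G := (nsmulAddMonoidHom p : G →+ G).ker
  have : Infinite V := Set.Infinite.to_subtype hinf
  obtain ⟨ι, b, hι, hb, hb0, hb'⟩ :=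
    exists_iSupIndep_zmultiples_of_elementary (G := V) hp fun x => Subtype.ext x.2
  have hinj : Function.Injective fun i => (b i : G) := Subtype.val_injective.comp hb
  have hind : iSupIndep fun i => AddSubgroup.zmultiples (b i : G) := by
    intro i
    have h3 := AddSubgroup.disjoint_map V.subtype_injective (hb' i)
    simp only [AddSubgroup.map_iSup, AddMonoidHom.map_zmultiples] at h3
    exact h3
  have hS : IsIndependentSystem (Set.range fun i => (b i : G)) := by
    constructor
    · rintro _ ⟨i, rfl⟩
      have h0 : (b i : G) ≠ 0 := fun h => hb0 i (Subtype.ext h)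
      have : Fact p.Prime := ⟨hp⟩
      refine ⟨h0, Or.inr ?_⟩
      rw [addOrderOf_eq_prime (b i).2 h0]
      exact hp.isPrimePow
    · have := hind.comp (Equiv.ofInjective _ hinj).symm.injective
      convert this using 2 with x
      exact congrArg _ (congrArg Subtype.val
        ((Equiv.ofInjective _ hinj).apply_symm_apply x)).symm
  -- An unbounded supremum of cardinals would default to `0`; smallness of the index type supplies
  -- the bound.
  have hle : Cardinal.mk (Set.range fun i => (b i : G)) ≤ rank G :=
    le_ciSup (f := fun S : {S : Set G // IsIndependentSystem S} => Cardinal.mk S.1)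
      Cardinal.bddAbove_of_small ⟨_, hS⟩
  rw [Cardinal.mk_range_eq _ hinj] at hle
  exact absurd h (not_lt.2 ((Cardinal.aleph0_le_mk ι).trans hle))

theorem finite_socle_primaryComponent_iff :
    {x : AddCommGroup.primaryComponent G p | p • x = 0}.Finite ↔ {x : G | p • x = 0}.Finite := by
  constructor
  · refine fun h => (h.image Subtype.val).subset fun x hx => ?_
    have hx' : p • x = 0 := hx
    exact ⟨⟨x, 1, by rw [pow_one, hx']⟩, Subtype.ext hx', rfl⟩
  · intro h
    refine Set.Finite.of_finite_image (h.subset ?_) Subtype.val_injective.injOn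
    rintro _ ⟨x, hx, rfl⟩
    have hx' : p • x = 0 := hx
    exact congrArg Subtype.val hx'

theorem exists_pow_nsmul_primaryComponent (x : AddCommGroup.primaryComponent G p) :
    ∃ k : ℕ, p ^ k • x = 0 :=
  let ⟨k, hk⟩ := AddCommGroup.mem_primaryComponent.1 x.2
  ⟨k, Subtype.ext hk⟩

theorem rank_primaryComponent_lt_iff (hp : p.Prime) :
    rank (AddCommGroup.primaryComponent G p) < Cardinal.aleph0 ↔ {x : G | p • x = 0}.Finite := by
  rw [← finite_socle_primaryComponent_iff]
  exact ⟨finite_socle_of_rank_lt hp, rank_lt_of_finite_socle exists_pow_nsmul_primaryComponent⟩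

/-- The `p`-component `T` of `R` has `p ^ N • T` divisible for some `N`. This subgroup lies in `D(G)
∩ R = 0`, so `T` is its own finite `p ^ N`-socle. -/
theorem IsReducedPart.finite_primaryComponent {R : AddSubgroup G} (hR : IsReducedPart R)
    (hp : p.Prime) (h : {x : R | p • x = 0}.Finite) :
    Finite (AddCommGroup.primaryComponent R p) := by
  let T := AddCommGroup.primaryComponent R p
  have hT : {x : T | p • x = 0}.Finite := finite_socle_primaryComponent_iff.2 h
  obtain ⟨N, hN⟩ := exists_pow_nsmul_eq_pow_succ_nsmul hT exists_pow_nsmul_primaryComponent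
  let P : AddSubgroup T := (nsmulAddMonoidHom (p ^ N) : T →+ T).range
  let j : P →+ G := R.subtype.comp (T.subtype.comp P.subtype)
  have hdiv : IsDivisibleSubgroup j.range := by
    rintro n hn _ ⟨x, rfl⟩
    obtain ⟨y, rfl⟩ := nsmul_surjective_of_prime hp (G := P) (fun x => by
        obtain ⟨k, hk⟩ := exists_pow_nsmul_primaryComponent x.1
        exact ⟨k, Subtype.ext hk⟩) (fun x => by
        obtain ⟨_, z, rfl⟩ := x
        obtain ⟨y, hy⟩ := hN z
        refine ⟨⟨_, y, rfl⟩, Subtype.ext ?_⟩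
        change p • p ^ N • y = p ^ N • z
        rw [hy, pow_succ', mul_smul]) hn x
    exact ⟨j y, ⟨y, rfl⟩, (map_nsmul j n y).symm⟩
  have hzero : ∀ x : T, p ^ N • x = 0 := by
    intro x
    have h1 : ((p ^ N • x : T) : R).1 ∈ divisiblePart G ⊓ R :=
      ⟨le_divisiblePart hdiv ⟨⟨_, x, rfl⟩, rfl⟩, ((p ^ N • x : T) : R).2⟩
    rw [hR.inf_eq_bot] at h1
    exact Subtype.ext (Subtype.ext h1)
  have hfin := finite_pow_socle hT N
  rw [Set.eq_univ_of_forall (s := {x : T | p ^ N • x = 0}) hzero] at hfin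
  exact Set.finite_univ_iff.1 hfin

theorem IsReducedPart.hasFiniteRanks_iff {R : AddSubgroup G} (hR : IsReducedPart R) :
    HasFiniteRanks G ↔
      torsionFreeRank (divisiblePart G) < Cardinal.aleph0 ∧
        (∀ (p : ℕ) [Fact p.Prime],
          rank (AddCommGroup.primaryComponent (divisiblePart G) p) < Cardinal.aleph0) ∧
        torsionFreeRank R < Cardinal.aleph0 ∧
        (∀ (p : ℕ) [Fact p.Prime], Finite (AddCommGroup.primaryComponent R p)) := by
  constructor
  · intro h
    refine ⟨(h.subgroup _).rank_lt, fun p hp => ?_, (h.subgroup R).rank_lt, fun p hp => ?_⟩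
    · exact (rank_primaryComponent_lt_iff hp.out).2 ((h.subgroup _).socle_finite p hp.out)
    · exact hR.finite_primaryComponent hp.out ((h.subgroup R).socle_finite p hp.out)
  · rintro ⟨h1, h2, h3, h4⟩
    refine ⟨?_, fun p hp => ?_⟩
    · have hsup : AddSubgroup.toIntSubmodule (divisiblePart G) ⊔ AddSubgroup.toIntSubmodule R =
          ⊤ := by
        rw [← map_sup, hR.sup_eq_top, map_top]
      have h5 := Submodule.rank_add_le_rank_add_rank (AddSubgroup.toIntSubmodule (divisiblePart G))
        (AddSubgroup.toIntSubmodule R)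
      rw [hsup, rank_top] at h5
      exact h5.trans_lt (Cardinal.add_lt_aleph0 h1 h3)
    · have : Fact p.Prime := ⟨hp⟩
      have hD := (rank_primaryComponent_lt_iff hp).1 (h2 p)
      have hR' : {x : R | p • x = 0}.Finite :=
        finite_socle_primaryComponent_iff.1 (have := h4 p; Set.toFinite _)
      -- Since `D(G) ∩ R = 0`, both components of a socle element are killed by `p`, so `G[p]` is
      -- contained in `D(G)[p] + R[p]`.
      refine ((hD.image Subtype.val).image2 (· + ·) (hR'.image Subtype.val)).subset fun x hx => ?_
      have hx' : p • x = 0 := hx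
      obtain ⟨d, hd, r, hr, rfl⟩ := AddSubgroup.mem_sup.1
        (show x ∈ divisiblePart G ⊔ R from hR.sup_eq_top ▸ AddSubgroup.mem_top x)
      rw [smul_add] at hx'
      have hd0 : p • d = 0 := by
        have : p • d ∈ divisiblePart G ⊓ R := ⟨AddSubgroup.nsmul_mem _ hd p, by
          rw [eq_neg_of_add_eq_zero_left hx']
          exact R.neg_mem (R.nsmul_mem hr p)⟩
        rwa [hR.inf_eq_bot] at this
      rw [hd0, zero_add] at hx'
      exact ⟨d, ⟨⟨d, hd⟩, Subtype.ext hd0, rfl⟩, r, ⟨⟨r, hr⟩, Subtype.ext hx', rfl⟩, rfl⟩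

end Parts

end RelCoHopf

theorem theorem2p40 (G : Type u) [AddCommGroup G] :
    (∀ R : AddSubgroup G, RelCoHopf.IsReducedPart R →
      (RelCoHopf.IsSuperRelativelyCoHopfian G ↔
        (RelCoHopf.torsionFreeRank (RelCoHopf.divisiblePart G) < Cardinal.aleph0 ∧
          (∀ (p : ℕ) [Fact p.Prime],
            RelCoHopf.rank (AddCommGroup.primaryComponent (RelCoHopf.divisiblePart G) p)
              < Cardinal.aleph0) ∧
          RelCoHopf.torsionFreeRank R < Cardinal.aleph0 ∧
          (∀ (p : ℕ) [Fact p.Prime], Finite (AddCommGroup.primaryComponent R p))))) ∧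
    (RelCoHopf.IsHereditarilyRelativelyCoHopfian G ↔
      RelCoHopf.IsSuperRelativelyCoHopfian G) := by
  have hsuper : RelCoHopf.IsSuperRelativelyCoHopfian G ↔ RelCoHopf.HasFiniteRanks G :=
    ⟨fun h => h.hasFiniteRanks, fun h => h.isSuperRelativelyCoHopfian⟩
  refine ⟨fun R hR => hsuper.trans hR.hasFiniteRanks_iff, ?_⟩
  rw [hsuper]
  exact ⟨fun h => h.hasFiniteRanks, fun h => h.isHereditarilyRelativelyCoHopfian⟩
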